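/- Let $k\ge 1$ and $m\ge k$ be integers and let $M\ge 0$. Let $A,B$ be elements of a complex unital Banach algebra with $\|1\|=1$ (for instance bounded operators on a nonzero Hilbert space) such that $\|A\|,\|B\|\le M$; let $0<\alpha\le 1$, let $H=A+\alpha B$, and let $\lambda\in\mathbb C$ with $|\lambda|\le 1$. Put $$S_2(\lambda)=e^{\lambda A/2}e^{\alpha\lambda B}e^{\lambda A/2},\qquad S_2^c(\lambda)=e^{C(\lambda)}S_2(\lambda)e^{-C(\lambda)},\qquad C(\lambda)=\alpha\sum_{j=1}^{m}\frac{B_{2j}(1/2)}{(2j)!}\,\lambda^{2j}\,\mathrm{ad}_A^{2j-1}(B),$$ where $B_n(x)$ are the Bernoulli polynomials and $\mathrm{ad}_A(X)=AX-XA$. For $l\ge 2$ define, by Suzuki's recursion with $p_l=1/(4-4^{1/(2l-1)})$, $$S^c_{2l}(\lambda)=\bigl[S^c_{2l-2}(p_l\lambda)\bigr]^2\,S^c_{2l-2}\bigl((1-4p_l)\lambda\bigr)\,\bigl[S^c_{2l-2}(p_l\lambda)\bigr]^2,$$ and define the standard product formulas $S_{2l}$ by the same recursion starting from $S_2$. Then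 there is a constant $K$ depending only on $k,m,M$ (not on the algebra, $A$, $B$, $\alpha$ or $\lambda$) such that $$\bigl\|e^{\lambda H}-S^c_{2k}(\lambda)\bigr\|\le K\bigl(\alpha^2|\lambda|^{2k+1}+\alpha|\lambda|^{2m+3}\bigr).$$ In particular the leading error is $\mathcal O(\alpha^2|\lambda|^{2k+1})$: whenever $|\lambda|^{2(m-k)+2}\le\alpha$ (that is, $|\lambda|^2\le\alpha$ for $m=k$), $$\bigl\|e^{\lambda H}-S^c_{2k}(\lambda)\bigr\|\le K\,\alpha^2|\lambda|^{2k+1},$$ which is a factor of $\alpha$ better than the bound for the standard product formula of order $2k$, $$\bigl\|e^{\lambda H}-S_{2k}(\lambda)\bigr\|\le K\,\alpha|\lambda|^{2k+1}.$$ -/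

import Mathlib

namespace CorrectedPF

noncomputable section

variable {𝔸 : Type*} [NormedRing 𝔸] [NormedAlgebra ℂ 𝔸]

/-- The coefficient `B_{2j}(1/2) / (2j)!`, with `B_n(x)` the Bernoulli polynomials. -/
def corrCoeff (j : ℕ) : ℚ :=
  (Polynomial.bernoulli (2 * j)).eval (1 / 2 : ℚ) / (Nat.factorial (2 * j) : ℚ)

/-- The commutator map `ad_A(X) = [A, X] = AX - XA`. -/
def adOp (A X : 𝔸) : 𝔸 := A * X - X * A

/-- The symplectic corrector of order `m`,
`C(m) = α ∑_{j=1}^m B_{2j}(1/2)/(2j)! z^{2j} ad_A^{2j-1}(B)`. -/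
def corrector (m : ℕ) (A B : 𝔸) (α : ℝ) (z : ℂ) : 𝔸 :=
  (α : ℂ) • ∑ j ∈ Finset.Icc 1 m,
    ((corrCoeff j : ℂ) * z ^ (2 * j)) • (adOp A)^[2 * j - 1] B

/-- The standard second-order formula `S₂(z) = e^{zA/2} e^{αzB} e^{zA/2}` for `A + αB`. -/
def pf2 (A B : 𝔸) (α : ℝ) (z : ℂ) : 𝔸 :=
  NormedSpace.exp ((z / 2) • A) * NormedSpace.exp (((α : ℂ) * z) • B) *
    NormedSpace.exp ((z / 2) • A)

/-- The corrected second-order formula `e^{C(m)} S₂(z) e^{-C(m)}`. -/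
def cpf2 (m : ℕ) (A B : 𝔸) (α : ℝ) (z : ℂ) : 𝔸 :=
  NormedSpace.exp (corrector m A B α z) * pf2 A B α z *
    NormedSpace.exp (-corrector m A B α z)

/-- Suzuki's parameter `p_k = 1 / (4 - 4^{1/(2k-1)})` (used for `k ≥ 2`). -/
def suzukiP (k : ℕ) : ℝ :=
  1 / (4 - (4 : ℝ) ^ (1 / (2 * (k : ℝ) - 1)))

/-- Suzuki's recursion. `suzuki S k` is the formula of order `2k` built from the second-order
formula `S = suzuki S 1`; the value at `k = 0` is a placeholder that is never used. -/
def suzuki (S : ℂ → 𝔸) : ℕ → ℂ → 𝔸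
  | 0 => fun _ => 1
  | 1 => S
  | k + 2 => fun z =>
      (suzuki S (k + 1) ((suzukiP (k + 2) : ℂ) * z)) ^ 2 *
        suzuki S (k + 1) ((1 - 4 * (suzukiP (k + 2) : ℂ)) * z) *
        (suzuki S (k + 1) ((suzukiP (k + 2) : ℂ) * z)) ^ 2

/-- The standard product formula of order `2k` for `A + αB`. -/
def pf (k : ℕ) (A B : 𝔸) (α : ℝ) : ℂ → 𝔸 :=
  suzuki (pf2 A B α) k

/-- The corrected product formula of order `2k` for `A + αB`, built from the second-order formula
corrected by `C(m)`. -/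
def cpf (m k : ℕ) (A B : 𝔸) (α : ℝ) : ℂ → 𝔸 :=
  suzuki (cpf2 m A B α) k

end

end CorrectedPF

/-!
Fix `z` and regard the corrected formula and the flow `exp (z • (A + t • B))` as entire functions of
a complex coupling `t`; they agree at `t = 0`. Symmetric composition makes their difference
`O(z ^ (2 * k + 1))` uniformly in the disc `‖t‖ ≤ 1`, and by the maximum principle the same bound
holds, up to a factor `‖t‖ ^ 2`, for what remains after subtracting the term linear in `t`.

By Duhamel's formula the linear term of the second-order formula is
`z • g (z • ad_A) B * exp (z • A)` with
`g x = exp (x / 2) - (exp x - 1) / x * ∑ j ≤ m, B_{2j}(1/2) / (2j)! * x ^ (2 * j)`. The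
generating function `x / (2 * sinh (x / 2))` of the numbers `B_n(1/2) / n!` shows that `g` vanishes
to order `2 * m + 2` at `0`: this is what determines the coefficients of the corrector. The product
rule propagates the resulting factor `z ^ (2 * m + 3)` through Suzuki's recursion. Without a
corrector, that is for `m = 0`, comparison at `t = 0` alone yields the factor `α` of the standard
formula.
-/

namespace CorrectedPF

section LeadingError

variable {E : Type*} [NormedAddCommGroup E] [NormedSpace ℂ E]

/-- Two entire functions `X` and `Y` agree to order `n` at the origin, with leading error `e`:
`X z = Y z + z ^ n (e + O(z))`. Order raising uses it in the time `z`; the part of an error that is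
linear in the coupling is a leading error of order one in the coupling. -/
structure HasLeadingError (n : ℕ) (X Y : ℂ → E) (e : E) : Prop where
  differentiable_right : Differentiable ℂ Y
  exists_eq : ∃ g : ℂ → E, Differentiable ℂ g ∧ g 0 = e ∧ ∀ z, X z = Y z + z ^ n • g z

namespace HasLeadingError

variable {n : ℕ} {X Y : ℂ → E} {e : E}

lemma differentiable_left (h : HasLeadingError n X Y e) : Differentiable ℂ X := by
  obtain ⟨g, hg, -, hX⟩ := h.exists_eq
  rw [funext hX]
  exact h.differentiable_right.add ((differentiable_id.pow n).smul hg)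

lemma apply_zero (hn : n ≠ 0) (h : HasLeadingError n X Y e) : X 0 = Y 0 := by
  obtain ⟨g, -, -, hX⟩ := h.exists_eq
  rw [hX, zero_pow hn, zero_smul, add_zero]

lemma unique {e' : E} (h : HasLeadingError n X Y e) (h' : HasLeadingError n X Y e') :
    e = e' := by
  obtain ⟨g, hg, rfl, hX⟩ := h.exists_eq
  obtain ⟨g', hg', rfl, hX'⟩ := h'.exists_eq
  have eq_off_zero : Set.EqOn g g' {0}ᶜ := fun z hz =>
    smul_right_injective E (pow_ne_zero n hz) (add_left_cancel ((hX z).symm.trans (hX' z)))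
  exact congrFun (hg.continuous.ext_on (dense_compl_singleton 0) hg'.continuous eq_off_zero) 0

lemma comp_mul (h : HasLeadingError n X Y e) (c : ℂ) :
    HasLeadingError n (fun z => X (c * z)) (fun z => Y (c * z)) (c ^ n • e) := by
  have hc : Differentiable ℂ fun z : ℂ => c * z := differentiable_id.const_mul c
  obtain ⟨g, hg, rfl, hX⟩ := h.exists_eq
  refine ⟨h.differentiable_right.comp hc, fun z => c ^ n • g (c * z),
    (hg.comp hc).const_smul _, by simp only [mul_zero], fun z => ?_⟩
  rw [hX, mul_pow, smul_smul, mul_comm (c ^ n)]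

lemma norm_sub_le_mul_pow (h : HasLeadingError n X Y e) {δ : ℝ}
    (hδ : ∀ z, ‖z‖ ≤ 1 → ‖X z - Y z‖ ≤ δ) {z : ℂ} (hz : ‖z‖ ≤ 1) :
    ‖X z - Y z‖ ≤ δ * ‖z‖ ^ n := by
  obtain ⟨g, hg, -, hX⟩ := h.exists_eq
  have norm_sub (w : ℂ) : ‖X w - Y w‖ = ‖g w‖ * ‖w‖ ^ n := by
    rw [hX, add_sub_cancel_left, norm_smul, norm_pow, mul_comm]
  have norm_g_le : ‖g z‖ ≤ δ := by
    refine Complex.norm_le_of_forall_mem_frontier_norm_le (U := Metric.ball (0 : ℂ) 1)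
      Metric.isBounded_ball hg.diffContOnCl (fun w hw => ?_) ?_
    · rw [frontier_ball _ one_ne_zero, mem_sphere_zero_iff_norm] at hw
      simpa only [norm_sub, hw, one_pow, mul_one] using hδ w hw.le
    · rwa [closure_ball _ one_ne_zero, mem_closedBall_zero_iff]
  rw [norm_sub]
  gcongr

variable [CompleteSpace E]

lemma exists_succ (h : HasLeadingError n X Y e) :
    ∃ e', HasLeadingError (n + 1) X (fun z => Y z + z ^ n • e) e' := by
  obtain ⟨g, hg, rfl, hX⟩ := h.exists_eq
  refine ⟨_, h.differentiable_right.add ((differentiable_id.pow n).smul_const _), dslope g 0, ?_,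
    rfl, fun z => ?_⟩
  · rw [← differentiableOn_univ, Complex.differentiableOn_dslope Filter.univ_mem]
    exact hg.differentiableOn
  · have quotient : z • dslope g 0 z = g z - g 0 := by simpa using sub_smul_dslope g 0 z
    rw [hX, pow_succ, mul_smul, quotient, smul_sub]
    abel

lemma exists_succ_of_zero (h : HasLeadingError n X Y 0) : ∃ e', HasLeadingError (n + 1) X Y e' := by
  simpa only [smul_zero, add_zero] using h.exists_succ

lemma norm_sub_le_of_norm_leading_le (h : HasLeadingError n X Y e) {δ : ℝ}
    (hδ : ∀ z, ‖z‖ ≤ 1 → ‖X z - Y z‖ ≤ δ) {ε : ℝ} (hε : ‖e‖ ≤ ε) {z : ℂ} (hz : ‖z‖ ≤ 1) :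
    ‖X z - Y z‖ ≤ ε * ‖z‖ ^ n + (δ + ε) * ‖z‖ ^ (n + 1) := by
  have norm_pow_smul_le (w : ℂ) : ‖w ^ n • e‖ ≤ ε * ‖w‖ ^ n := by
    rw [norm_smul, norm_pow, mul_comm]
    gcongr
  obtain ⟨e', h'⟩ := h.exists_succ
  have remainder_le : ‖X z - (Y z + z ^ n • e)‖ ≤ (δ + ε) * ‖z‖ ^ (n + 1) := by
    refine h'.norm_sub_le_mul_pow (fun w hw => ?_) hz
    have hε0 : 0 ≤ ε := (norm_nonneg e).trans hε
    calc ‖X w - (Y w + w ^ n • e)‖ = ‖X w - Y w - w ^ n • e‖ := by rw [sub_sub]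
      _ ≤ ‖X w - Y w‖ + ‖w ^ n • e‖ := norm_sub_le _ _
      _ ≤ δ + ε := add_le_add (hδ w hw) ((norm_pow_smul_le w).trans
          (mul_le_of_le_one_right hε0 (pow_le_one₀ (norm_nonneg w) hw)))
  calc ‖X z - Y z‖ = ‖z ^ n • e + (X z - (Y z + z ^ n • e))‖ := by congr 1; abel
    _ ≤ ‖z ^ n • e‖ + ‖X z - (Y z + z ^ n • e)‖ := norm_add_le _ _
    _ ≤ _ := add_le_add (norm_pow_smul_le z) remainder_le

end HasLeadingError

lemma hasLeadingError_one_of_hasDerivAt [CompleteSpace E] {X Y : ℂ → E}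
    (hX : Differentiable ℂ X) (hY : Differentiable ℂ Y) (h0 : X 0 = Y 0) {a b : E}
    (ha : HasDerivAt X a 0) (hb : HasDerivAt Y b 0) : HasLeadingError 1 X Y (a - b) := by
  refine ⟨hY, dslope (fun z => X z - Y z) 0, ?_, ?_, fun z => ?_⟩
  · rw [← differentiableOn_univ, Complex.differentiableOn_dslope Filter.univ_mem]
    exact (hX.sub hY).differentiableOn
  · rw [dslope_same]
    exact (ha.sub hb).deriv
  · have quotient := sub_smul_dslope (fun z => X z - Y z) 0 z
    rw [sub_zero, h0, sub_self, sub_zero] at quotient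
    rw [pow_one, quotient, add_sub_cancel]

lemma HasLeadingError.mul {𝔸 : Type*} [NormedRing 𝔸] [NormedAlgebra ℂ 𝔸] {n : ℕ}
    {X Y X' Y' : ℂ → 𝔸} {e e' : 𝔸} (h : HasLeadingError n X Y e)
    (h' : HasLeadingError n X' Y' e') :
    HasLeadingError n (fun z => X z * X' z) (fun z => Y z * Y' z) (e * X' 0 + Y 0 * e') := by
  obtain ⟨g, hg, rfl, hX⟩ := h.exists_eq
  obtain ⟨g', hg', rfl, hX'⟩ := h'.exists_eq
  refine ⟨h.differentiable_right.mul h'.differentiable_right, fun z => g z * X' z + Y z * g' z,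
    (hg.mul h'.differentiable_left).add (h.differentiable_right.mul hg'), rfl, fun z => ?_⟩
  calc X z * X' z = Y z * X' z + z ^ n • (g z * X' z) := by rw [hX, add_mul, smul_mul_assoc]
    _ = Y z * (Y' z + z ^ n • g' z) + z ^ n • (g z * X' z) := by rw [← hX']
    _ = Y z * Y' z + z ^ n • (g z * X' z + Y z * g' z) := by
      rw [mul_add, mul_smul_comm, smul_add]
      abel

end LeadingError

section Exponential

variable {𝔸 : Type*} [NormedRing 𝔸] [NormedAlgebra ℂ 𝔸]

lemma norm_exp_le [NormOneClass 𝔸] (x : 𝔸) : ‖NormedSpace.exp x‖ ≤ Real.exp ‖x‖ := by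
  have real_exp : HasSum (fun n : ℕ => ‖x‖ ^ n / n.factorial) (Real.exp ‖x‖) := by
    rw [Real.exp_eq_exp_ℝ]
    exact NormedSpace.expSeries_div_hasSum_exp ‖x‖
  rw [NormedSpace.exp_eq_tsum ℂ]
  refine tsum_of_norm_bounded real_exp fun n => ?_
  rw [norm_smul, norm_inv, Complex.norm_natCast, div_eq_inv_mul]
  gcongr
  exact norm_pow_le x n

lemma norm_exp_le_of_le [NormOneClass 𝔸] {x : 𝔸} {r : ℝ} (h : ‖x‖ ≤ r) :
    ‖NormedSpace.exp x‖ ≤ Real.exp r :=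
  (norm_exp_le x).trans (Real.exp_le_exp.2 h)

variable [CompleteSpace 𝔸]

lemma differentiable_exp : Differentiable ℂ (NormedSpace.exp : 𝔸 → 𝔸) := fun x =>
  (NormedSpace.exp_analytic x).differentiableAt

lemma exp_mul_exp_neg (x : 𝔸) : NormedSpace.exp x * NormedSpace.exp (-x) = 1 := by
  let : NormedAlgebra ℚ 𝔸 := NormedAlgebra.restrictScalars ℚ ℂ 𝔸
  rw [← NormedSpace.exp_add_of_commute (Commute.refl x).neg_right, add_neg_cancel,
    NormedSpace.exp_zero]

lemma exp_neg_mul_exp (x : 𝔸) : NormedSpace.exp (-x) * NormedSpace.exp x = 1 := by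
  simpa using exp_mul_exp_neg (-x)

lemma exp_smul_mul_exp_smul (x : 𝔸) (a b : ℂ) :
    NormedSpace.exp (a • x) * NormedSpace.exp (b • x) = NormedSpace.exp ((a + b) • x) := by
  let : NormedAlgebra ℚ 𝔸 := NormedAlgebra.restrictScalars ℚ ℂ 𝔸
  rw [← NormedSpace.exp_add_of_commute (((Commute.refl x).smul_left a).smul_right b), add_smul]

lemma hasDerivAt_exp_smul_zero (X : 𝔸) :
    HasDerivAt (fun t : ℂ => NormedSpace.exp (t • X)) X 0 := by
  simpa using hasDerivAt_exp_smul_const X (0 : ℂ)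

end Exponential

section SuzukiParameter

lemma exists_suzukiP_eq (k : ℕ) :
    ∃ s : ℝ, 0 < s ∧ s ≤ 2 ∧ s ^ (2 * k + 3) = 4 ∧ suzukiP (k + 2) = 1 / (4 - s) := by
  have exponent : 2 * ((k + 2 : ℕ) : ℝ) - 1 = ((2 * k + 3 : ℕ) : ℝ) := by push_cast; ring
  have root_pow : ((4 : ℝ) ^ ((2 * k + 3 : ℕ) : ℝ)⁻¹) ^ (2 * k + 3) = 4 :=
    Real.rpow_inv_natCast_pow (by norm_num) (by omega)
  refine ⟨(4 : ℝ) ^ ((2 * k + 3 : ℕ) : ℝ)⁻¹, by positivity, ?_, root_pow, ?_⟩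
  · refine le_of_pow_le_pow_left₀ (n := 2 * k + 3) (by omega) (by norm_num) ?_
    calc _ = (2 : ℝ) ^ 2 := by rw [root_pow]; norm_num
      _ ≤ 2 ^ (2 * k + 3) := pow_le_pow_right₀ (by norm_num) (by omega)
  · rw [suzukiP, exponent, one_div (((2 * k + 3 : ℕ) : ℝ))]

lemma abs_suzukiP_le_one (k : ℕ) : |suzukiP (k + 2)| ≤ 1 := by
  obtain ⟨s, -, hs2, -, hp⟩ := exists_suzukiP_eq k
  rw [hp, abs_of_pos (by apply one_div_pos.2; linarith), div_le_one (by linarith)]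
  linarith

lemma abs_one_sub_four_mul_suzukiP_le_one (k : ℕ) : |1 - 4 * suzukiP (k + 2)| ≤ 1 := by
  obtain ⟨s, hs0, hs2, -, hp⟩ := exists_suzukiP_eq k
  have middle_step : 1 - 4 * suzukiP (k + 2) = -(s / (4 - s)) := by
    have : 4 - s ≠ 0 := by linarith
    rw [hp]; field_simp; ring
  rw [middle_step, abs_neg, abs_of_pos (div_pos hs0 (by linarith)), div_le_one (by linarith)]
  linarith

lemma suzukiP_cancel (k : ℕ) : 4 * (suzukiP (k + 2) : ℂ) ^ (2 * k + 3) +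
    (1 - 4 * (suzukiP (k + 2) : ℂ)) ^ (2 * k + 3) = 0 := by
  obtain ⟨s, -, hs2, hs, hp⟩ := exists_suzukiP_eq k
  have middle_step : 1 - 4 * suzukiP (k + 2) = -(s * suzukiP (k + 2)) := by
    have : 4 - s ≠ 0 := by linarith
    rw [hp]; field_simp; ring
  have cancel_real :
      4 * suzukiP (k + 2) ^ (2 * k + 3) + (1 - 4 * suzukiP (k + 2)) ^ (2 * k + 3) = 0 := by
    rw [middle_step, Odd.neg_pow ⟨k + 1, by ring⟩, mul_pow, hs]
    ring
  exact_mod_cast congrArg (fun x : ℝ => (x : ℂ)) cancel_real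

lemma norm_suzukiP_mul_le (k : ℕ) (z : ℂ) : ‖(suzukiP (k + 2) : ℂ) * z‖ ≤ ‖z‖ := by
  rw [norm_mul, Complex.norm_real]
  exact mul_le_of_le_one_left (norm_nonneg z) (abs_suzukiP_le_one k)

lemma norm_one_sub_four_mul_suzukiP_mul_le (k : ℕ) (z : ℂ) :
    ‖(1 - 4 * (suzukiP (k + 2) : ℂ)) * z‖ ≤ ‖z‖ := by
  have real_factor : (1 - 4 * (suzukiP (k + 2) : ℂ)) = ((1 - 4 * suzukiP (k + 2) : ℝ) : ℂ) := by
    push_cast; ring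
  rw [norm_mul, real_factor, Complex.norm_real]
  exact mul_le_of_le_one_left (norm_nonneg z) (abs_one_sub_four_mul_suzukiP_le_one k)

end SuzukiParameter

section SuzukiStep

/-- The fivefold composition in Suzuki's recursion, with `x` the outer and `y` the middle factor. -/
def suzukiStep {R : Type*} [Monoid R] (x y : R) : R :=
  x ^ 2 * y * x ^ 2

lemma suzuki_succ_succ {𝔸 : Type*} [NormedRing 𝔸] (S : ℂ → 𝔸) (k : ℕ) (z : ℂ) :
    suzuki S (k + 2) z = suzukiStep (suzuki S (k + 1) ((suzukiP (k + 2) : ℂ) * z))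
      (suzuki S (k + 1) ((1 - 4 * (suzukiP (k + 2) : ℂ)) * z)) :=
  rfl

lemma suzukiStep_mul_eq_one {R : Type*} [Monoid R] {x y x' y' : R} (hx : x * x' = 1)
    (hy : y * y' = 1) : suzukiStep x y * suzukiStep x' y' = 1 := by
  have cancel_sq : x ^ 2 * x' ^ 2 = 1 := by
    rw [pow_two, pow_two, mul_assoc, ← mul_assoc x x', hx, one_mul, hx]
  calc suzukiStep x y * suzukiStep x' y' = x ^ 2 * (y * (x ^ 2 * x' ^ 2) * y') * x' ^ 2 := by
        simp only [suzukiStep, mul_assoc]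
    _ = 1 := by rw [cancel_sq, mul_one, hy, mul_one, cancel_sq]

lemma norm_suzukiStep_le {R : Type*} [NormedRing R] {x y : R} {L : ℝ} (hx : ‖x‖ ≤ L)
    (hy : ‖y‖ ≤ L) : ‖suzukiStep x y‖ ≤ L ^ 5 := by
  have hL : 0 ≤ L := (norm_nonneg x).trans hx
  have norm_sq_le : ‖x ^ 2‖ ≤ L ^ 2 := (norm_pow_le' x two_pos).trans (by gcongr)
  calc ‖suzukiStep x y‖ ≤ ‖x ^ 2‖ * ‖y‖ * ‖x ^ 2‖ := norm_mul₃_le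
    _ ≤ L ^ 2 * L * L ^ 2 := by gcongr
    _ = L ^ 5 := by ring

/-- The derivative of `suzukiStep` at `(x, y)` in the direction `(e, e')`. -/
def suzukiStepDeriv {R : Type*} [Semiring R] (x y e e' : R) : R :=
  (e * x + x * e) * y * x ^ 2 + x ^ 2 * e' * x ^ 2 + x ^ 2 * y * (e * x + x * e)

lemma norm_suzukiStepDeriv_le {R : Type*} [NormedRing R] {x y e e' : R} {L ε : ℝ}
    (hx : ‖x‖ ≤ L) (hy : ‖y‖ ≤ L) (he : ‖e‖ ≤ ε) (he' : ‖e'‖ ≤ ε) :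
    ‖suzukiStepDeriv x y e e'‖ ≤ 5 * L ^ 4 * ε := by
  have hL : 0 ≤ L := (norm_nonneg x).trans hx
  have hε : 0 ≤ ε := (norm_nonneg e).trans he
  have norm_sq_le : ‖x ^ 2‖ ≤ L ^ 2 := (norm_pow_le' x two_pos).trans (by gcongr)
  have norm_sq_deriv_le : ‖e * x + x * e‖ ≤ ε * L + L * ε :=
    norm_add_le_of_le (norm_mul_le_of_le he hx) (norm_mul_le_of_le hx he)
  calc ‖suzukiStepDeriv x y e e'‖
      ≤ (ε * L + L * ε) * L * L ^ 2 + L ^ 2 * ε * L ^ 2 + L ^ 2 * L * (ε * L + L * ε) :=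
        norm_add₃_le.trans (by gcongr <;> refine norm_mul₃_le.trans ?_ <;> gcongr)
    _ = 5 * L ^ 4 * ε := by ring

variable {𝔸 : Type*} [NormedRing 𝔸] [NormedAlgebra ℂ 𝔸]

lemma HasLeadingError.suzukiStep {n : ℕ} (hn : n ≠ 0) {X Y X' Y' : ℂ → 𝔸} {e e' : 𝔸}
    (h : HasLeadingError n X Y e) (h' : HasLeadingError n X' Y' e') :
    HasLeadingError n (fun z => suzukiStep (X z) (X' z)) (fun z => suzukiStep (Y z) (Y' z))
      (suzukiStepDeriv (Y 0) (Y' 0) e e') := by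
  have square := h.mul h
  convert (square.mul h').mul square using 1
  · simp only [CorrectedPF.suzukiStep, pow_two]
  · simp only [CorrectedPF.suzukiStep, pow_two]
  · simp only [suzukiStepDeriv, h.apply_zero hn, h'.apply_zero hn, pow_two]
    noncomm_ring

variable [CompleteSpace 𝔸]

lemma suzukiStep_exp_smul (H : 𝔸) (k : ℕ) (z : ℂ) :
    suzukiStep (NormedSpace.exp (((suzukiP (k + 2) : ℂ) * z) • H))
      (NormedSpace.exp (((1 - 4 * (suzukiP (k + 2) : ℂ)) * z) • H)) =
    NormedSpace.exp (z • H) := by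
  simp only [suzukiStep, pow_two, exp_smul_mul_exp_smul]
  congr 2
  ring

end SuzukiStep

section SuzukiRecursion

variable {𝔸 : Type*} [NormedRing 𝔸]

lemma suzuki_mul_suzuki_neg {S : ℂ → 𝔸} (hS : ∀ z, S z * S (-z) = 1) (k : ℕ) (z : ℂ) :
    suzuki S (k + 1) z * suzuki S (k + 1) (-z) = 1 := by
  induction k generalizing z with
  | zero => exact hS z
  | succ k ih =>
    rw [suzuki_succ_succ, suzuki_succ_succ, mul_neg, mul_neg]
    exact suzukiStep_mul_eq_one (ih _) (ih _)

lemma norm_suzuki_le {S : ℂ → 𝔸} {L r : ℝ} (hS : ∀ z, ‖z‖ ≤ r → ‖S z‖ ≤ L) (k : ℕ) {z : ℂ}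
    (hz : ‖z‖ ≤ r) : ‖suzuki S (k + 1) z‖ ≤ L ^ 5 ^ k := by
  induction k generalizing z with
  | zero => simpa only [pow_zero, pow_one] using! hS z hz
  | succ k ih =>
    rw [pow_succ, pow_mul, suzuki_succ_succ]
    exact norm_suzukiStep_le (ih ((norm_suzukiP_mul_le k z).trans hz))
      (ih ((norm_one_sub_four_mul_suzukiP_mul_le k z).trans hz))

variable [NormedAlgebra ℂ 𝔸] [CompleteSpace 𝔸]

lemma exists_hasLeadingError_suzuki {n : ℕ} (hn : n ≠ 0) {S : ℂ → ℂ → 𝔸} {H : ℂ → 𝔸}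
    {L ε r : ℝ} (hH : ∀ z : ℂ, ‖z‖ ≤ r → ‖NormedSpace.exp (z • H 0)‖ ≤ L)
    (hS : ∀ z : ℂ, ‖z‖ ≤ r → ∃ e, ‖e‖ ≤ ε ∧
      HasLeadingError n (fun t => S t z) (fun t => NormedSpace.exp (z • H t)) e)
    (k : ℕ) {z : ℂ} (hz : ‖z‖ ≤ r) :
    ∃ e, ‖e‖ ≤ (5 * L ^ 4) ^ k * ε ∧ HasLeadingError n (fun t => suzuki (S t) (k + 1) z)
      (fun t => NormedSpace.exp (z • H t)) e := by
  induction k generalizing z with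
  | zero => simpa only [pow_zero, one_mul] using! hS z hz
  | succ k ih =>
    have outer_le := (norm_suzukiP_mul_le k z).trans hz
    have middle_le := (norm_one_sub_four_mul_suzukiP_mul_le k z).trans hz
    obtain ⟨e, he, h⟩ := ih outer_le
    obtain ⟨e', he', h'⟩ := ih middle_le
    have step := h.suzukiStep hn h'
    simp only [suzukiStep_exp_smul, ← suzuki_succ_succ] at step
    refine ⟨_, ?_, step⟩
    rw [pow_succ', mul_assoc]
    exact norm_suzukiStepDeriv_le (hH _ outer_le) (hH _ middle_le) he he'

end SuzukiRecursion

section Order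

variable {𝔸 : Type*} [NormedRing 𝔸] [NormedAlgebra ℂ 𝔸]

/-- `S` is a product formula of order at least `n` for the flow `z ↦ exp (z • H)`. -/
def IsOrder (n : ℕ) (S : ℂ → 𝔸) (H : 𝔸) : Prop :=
  ∃ e, HasLeadingError (n + 1) S (fun z => NormedSpace.exp (z • H)) e

variable {n : ℕ} {S : ℂ → 𝔸} {H : 𝔸}

lemma IsOrder.norm_sub_exp_le (h : IsOrder n S H) {δ : ℝ}
    (hδ : ∀ z : ℂ, ‖z‖ ≤ 1 → ‖S z - NormedSpace.exp (z • H)‖ ≤ δ) {z : ℂ} (hz : ‖z‖ ≤ 1) :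
    ‖S z - NormedSpace.exp (z • H)‖ ≤ δ * ‖z‖ ^ (n + 1) := by
  obtain ⟨e, he⟩ := h
  exact he.norm_sub_le_mul_pow hδ hz

lemma IsOrder.apply_zero (h : IsOrder n S H) : S 0 = 1 := by
  obtain ⟨e, he⟩ := h
  simpa using he.apply_zero n.succ_ne_zero

variable [CompleteSpace 𝔸]

lemma isOrder_one_of_hasDerivAt (hS : Differentiable ℂ S) (h0 : S 0 = 1)
    (hS' : HasDerivAt S H 0) : IsOrder 1 S H := by
  have leading := hasLeadingError_one_of_hasDerivAt hS
    (differentiable_exp.comp (differentiable_id.smul_const H)) (by simpa using h0) hS'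
    (hasDerivAt_exp_smul_zero H)
  rw [sub_self] at leading
  exact leading.exists_succ_of_zero

/-- Reflecting time multiplies the leading error, of even degree `n + 1`, by `1`; so comparing
`S z * S (-z) = 1` with the flow doubles it. -/
lemma IsOrder.succ_of_symmetric (h : IsOrder n S H) (hn : Odd n) (hS : ∀ z, S z * S (-z) = 1) :
    IsOrder (n + 1) S H := by
  have S_zero := h.apply_zero
  obtain ⟨e, he⟩ := h
  have product := he.mul (he.comp_mul (-1))
  simp only [neg_one_mul, hS, neg_smul, exp_mul_exp_neg, hn.add_one.neg_one_pow, one_smul,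
    neg_zero, S_zero, zero_smul, NormedSpace.exp_zero, mul_one, one_mul] at product
  have trivial_error : HasLeadingError (n + 1) (fun _ : ℂ => (1 : 𝔸)) (fun _ => 1) 0 :=
    ⟨differentiable_const 1, fun _ => 0, differentiable_const 0, rfl, by simp⟩
  have two_smul_e : (2 : ℂ) • e = 0 := by
    rw [two_smul]
    exact product.unique trivial_error
  have e_eq_zero : e = 0 := (smul_eq_zero.1 two_smul_e).resolve_left two_ne_zero
  exact (e_eq_zero ▸ he).exists_succ_of_zero

lemma IsOrder.suzuki_succ {k : ℕ} (h : IsOrder (2 * k + 2) (suzuki S (k + 1)) H) :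
    IsOrder (2 * k + 3) (suzuki S (k + 2)) H := by
  obtain ⟨e, he⟩ := h
  have step := (he.comp_mul (suzukiP (k + 2) : ℂ)).suzukiStep (by omega)
    (he.comp_mul (1 - 4 * (suzukiP (k + 2) : ℂ)))
  simp only [suzukiStep_exp_smul, ← suzuki_succ_succ] at step
  have error_eq_zero : suzukiStepDeriv (1 : 𝔸) 1 ((suzukiP (k + 2) : ℂ) ^ (2 * k + 3) • e)
      ((1 - 4 * (suzukiP (k + 2) : ℂ)) ^ (2 * k + 3) • e) = 0 := by
    calc _ = (4 * (suzukiP (k + 2) : ℂ) ^ (2 * k + 3)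
          + (1 - 4 * (suzukiP (k + 2) : ℂ)) ^ (2 * k + 3)) • e := by
          simp only [suzukiStepDeriv, one_pow, one_mul, mul_one]
          module
      _ = 0 := by rw [suzukiP_cancel, zero_smul]
  simp only [mul_zero, zero_smul, NormedSpace.exp_zero] at step
  exact (error_eq_zero ▸ step).exists_succ_of_zero

lemma isOrder_suzuki (h : IsOrder 2 S H) (hS : ∀ z, S z * S (-z) = 1) (k : ℕ) :
    IsOrder (2 * k + 2) (suzuki S (k + 1)) H := by
  induction k with
  | zero => exact h
  | succ k ih =>
    exact ih.suzuki_succ.succ_of_symmetric ⟨k + 1, by ring⟩ (suzuki_mul_suzuki_neg hS (k + 1))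

end Order

section EntireSeries

open PowerSeries
open Finset.HasAntidiagonal (antidiagonal mem_antidiagonal)

variable {𝕜 : Type*} [NormedField 𝕜]

/-- A power series with infinite radius of convergence. -/
def IsEntire (p : 𝕜⟦X⟧) : Prop :=
  ∀ r : ℝ, 0 ≤ r → Summable fun n => ‖coeff n p‖ * r ^ n

/-- The value of the power series `p` at an element of a normed algebra. -/
noncomputable def evalSeries {R : Type*} [NormedRing R] [NormedAlgebra 𝕜 R] (p : 𝕜⟦X⟧)
    (x : R) : R :=
  ∑' n, coeff n p • x ^ n

lemma isEntire_coe_polynomial (p : Polynomial 𝕜) : IsEntire (p : 𝕜⟦X⟧) := fun r _ =>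
  summable_of_ne_finset_zero (s := p.support) fun n hn => by
    rw [Polynomial.coeff_coe, Polynomial.notMem_support_iff.1 hn, norm_zero, zero_mul]

lemma IsEntire.sub {p q : 𝕜⟦X⟧} (hp : IsEntire p) (hq : IsEntire q) : IsEntire (p - q) :=
  fun r hr => ((hp r hr).add (hq r hr)).of_nonneg_of_le (fun _ => by positivity) fun n => by
    rw [map_sub, ← add_mul]
    gcongr
    exact norm_sub_le _ _

lemma IsEntire.mul {p q : 𝕜⟦X⟧} (hp : IsEntire p) (hq : IsEntire q) : IsEntire (p * q) := by
  intro r hr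
  have cauchy_product := summable_norm_sum_mul_antidiagonal_of_summable_norm
    (hp r hr).norm (hq r hr).norm
  refine cauchy_product.of_nonneg_of_le (fun _ => by positivity) fun n => ?_
  calc ‖coeff n (p * q)‖ * r ^ n
      ≤ (∑ ij ∈ antidiagonal n, ‖coeff ij.1 p‖ * ‖coeff ij.2 q‖) * r ^ n := by
        rw [coeff_mul]
        gcongr
        exact (norm_sum_le _ _).trans_eq (Finset.sum_congr rfl fun _ _ => norm_mul _ _)
    _ = ∑ ij ∈ antidiagonal n, ‖coeff ij.1 p‖ * r ^ ij.1 * (‖coeff ij.2 q‖ * r ^ ij.2) := by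
        rw [Finset.sum_mul]
        refine Finset.sum_congr rfl fun ij hij => ?_
        rw [← mem_antidiagonal.1 hij, pow_add]
        ring
    _ ≤ _ := le_abs_self _

variable {R : Type*} [NormedRing R] [NormedAlgebra 𝕜 R]

lemma evalSeries_coe_polynomial (p : Polynomial 𝕜) (x : R) :
    evalSeries (p : 𝕜⟦X⟧) x = Polynomial.aeval x p := by
  rw [evalSeries, Polynomial.aeval_eq_sum_range,
    tsum_eq_sum (s := Finset.range (p.natDegree + 1))]
  · simp only [Polynomial.coeff_coe]
  · intro n hn
    rw [Polynomial.coeff_coe, Polynomial.coeff_eq_zero_of_natDegree_lt, zero_smul]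
    simpa only [Finset.mem_range, not_lt, Nat.succ_le_iff] using hn

variable [NormOneClass R]

lemma IsEntire.summable_norm {p : 𝕜⟦X⟧} (hp : IsEntire p) (x : R) :
    Summable fun n => ‖coeff n p • x ^ n‖ :=
  (hp ‖x‖ (norm_nonneg x)).of_nonneg_of_le (fun _ => norm_nonneg _) fun n => by
    rw [norm_smul]
    gcongr
    exact norm_pow_le x n

lemma norm_evalSeries_smul_le {p : 𝕜⟦X⟧} (hp : IsEntire p) {N : ℕ} (hN : X ^ N ∣ p) {x : R}
    {r : ℝ} (hx : ‖x‖ ≤ r) {c : 𝕜} (hc : ‖c‖ ≤ 1) :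
    ‖evalSeries p (c • x)‖ ≤ (∑' n, ‖coeff n p‖ * r ^ n) * ‖c‖ ^ N := by
  have hr : 0 ≤ r := (norm_nonneg x).trans hx
  refine tsum_of_norm_bounded ((hp r hr).hasSum.mul_right _) fun n => ?_
  rcases lt_or_ge n N with hn | hn
  · rw [X_pow_dvd_iff.1 hN n hn, zero_smul, norm_zero]
    positivity
  · calc ‖coeff n p • (c • x) ^ n‖ = ‖coeff n p‖ * (‖c‖ ^ n * ‖x ^ n‖) := by
          rw [norm_smul, smul_pow, norm_smul, norm_pow]
      _ ≤ ‖coeff n p‖ * (‖c‖ ^ N * r ^ n) := by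
          have norm_pow_le_pow : ‖x ^ n‖ ≤ r ^ n := (norm_pow_le x n).trans (by gcongr)
          gcongr ?_ * (?_ * ?_)
          exact pow_le_pow_of_le_one (norm_nonneg c) hc hn
      _ = ‖coeff n p‖ * r ^ n * ‖c‖ ^ N := by ring

variable [CompleteSpace R]

lemma evalSeries_sub {p q : 𝕜⟦X⟧} (hp : IsEntire p) (hq : IsEntire q) (x : R) :
    evalSeries (p - q) x = evalSeries p x - evalSeries q x := by
  simp only [evalSeries, map_sub, sub_smul]
  exact (hp.summable_norm x).of_norm.tsum_sub (hq.summable_norm x).of_norm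

lemma evalSeries_mul {p q : 𝕜⟦X⟧} (hp : IsEntire p) (hq : IsEntire q) (x : R) :
    evalSeries (p * q) x = evalSeries p x * evalSeries q x := by
  rw [evalSeries, evalSeries, evalSeries, tsum_mul_tsum_eq_tsum_sum_antidiagonal_of_summable_norm
    (hp.summable_norm x) (hq.summable_norm x)]
  refine tsum_congr fun n => ?_
  rw [coeff_mul, Finset.sum_smul]
  refine Finset.sum_congr rfl fun ij hij => ?_
  rw [← mem_antidiagonal.1 hij, pow_add, smul_mul_smul_comm]

end EntireSeries

section ExponentialSeries

open PowerSeries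

lemma isEntire_rescale_exp (c : ℂ) : IsEntire (rescale c (exp ℂ)) := fun r _ => by
  refine (Real.summable_pow_div_factorial (‖c‖ * r)).congr fun n => ?_
  rw [coeff_rescale, coeff_exp, norm_mul, norm_pow, one_div, map_inv₀, map_natCast, norm_inv,
    Complex.norm_natCast, mul_pow]
  ring

/-- The power series of `(exp x - 1) / x`. -/
noncomputable def expQuot : ℂ⟦X⟧ :=
  PowerSeries.mk fun n => ((n + 1).factorial : ℂ)⁻¹

lemma X_mul_expQuot : X * expQuot = exp ℂ - 1 := by
  ext n
  cases n with
  | zero => simp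
  | succ n => simp [expQuot, coeff_succ_X_mul, coeff_exp, coeff_one]

lemma isEntire_expQuot : IsEntire expQuot := fun r hr => by
  refine (Real.summable_pow_div_factorial r).of_nonneg_of_le (fun _ => by positivity) fun n => ?_
  rw [expQuot, coeff_mk, norm_inv, Complex.norm_natCast, div_eq_inv_mul]
  gcongr
  exact n.le_succ

variable {R : Type*} [NormedRing R] [NormedAlgebra ℂ R]

lemma evalSeries_rescale_exp (c : ℂ) (x : R) :
    evalSeries (rescale c (exp ℂ)) x = NormedSpace.exp (c • x) := by
  rw [evalSeries, NormedSpace.exp_eq_tsum ℂ]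
  refine tsum_congr fun n => ?_
  rw [coeff_rescale, coeff_exp, smul_pow, smul_smul, mul_comm (c ^ n)]
  simp

lemma evalSeries_expQuot_mul [NormOneClass R] [CompleteSpace R] (x : R) :
    evalSeries expQuot x * x = NormedSpace.exp x - 1 := by
  have series_identity :
      expQuot * ((Polynomial.X : Polynomial ℂ) : ℂ⟦X⟧) =
        rescale 1 (exp ℂ) - ((1 : Polynomial ℂ) : ℂ⟦X⟧) := by
    rw [Polynomial.coe_X, Polynomial.coe_one, rescale_one, RingHom.id_apply, mul_comm,
      X_mul_expQuot]
  have evaluated := congrArg (evalSeries · x) series_identity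
  simpa only [evalSeries_mul isEntire_expQuot (isEntire_coe_polynomial _),
    evalSeries_sub (isEntire_rescale_exp 1) (isEntire_coe_polynomial _), evalSeries_rescale_exp,
    evalSeries_coe_polynomial, Polynomial.aeval_X, map_one, one_smul] using evaluated

end ExponentialSeries

section Bernoulli

open PowerSeries

/-- The generating series `∑ B_n(1/2) / n! X ^ n` of the Bernoulli numbers at `1/2`, that is,
`x / (2 sinh (x/2))`. -/
noncomputable def bernoulliHalfSeries : ℂ⟦X⟧ :=
  PowerSeries.mk fun n => (((Polynomial.bernoulli n).eval (1 / 2 : ℚ) / n.factorial : ℚ) : ℂ)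

/-- The truncation of `bernoulliHalfSeries` below degree `2 * m + 2`. -/
noncomputable def bernoulliPoly (m : ℕ) : Polynomial ℂ :=
  ∑ j ∈ Finset.range (m + 1), Polynomial.monomial (2 * j) (corrCoeff j : ℂ)

/-- The series `g` for which the corrected second-order formula differs from the flow, to first
order in the coupling, by `z • g (z • ad_A) B * exp (z • A)`. -/
noncomputable def residualSeries (m : ℕ) : ℂ⟦X⟧ :=
  rescale (1 / 2 : ℂ) (exp ℂ) - expQuot * (bernoulliPoly m : ℂ⟦X⟧)

lemma bernoulliHalfSeries_mul_expQuot :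
    bernoulliHalfSeries * expQuot = rescale (1 / 2 : ℂ) (exp ℂ) := by
  have generating_series : bernoulliHalfSeries = PowerSeries.mk fun n : ℕ =>
      Polynomial.aeval (1 / 2 : ℂ) ((1 / n.factorial : ℚ) • Polynomial.bernoulli n) := by
    ext n
    have half : (1 / 2 : ℂ) = algebraMap ℚ ℂ (1 / 2) := by simp
    rw [bernoulliHalfSeries, coeff_mk, coeff_mk, map_smul, half, Polynomial.aeval_algebraMap_apply,
      Polynomial.coe_aeval_eq_eval, Rat.smul_def, eq_ratCast, ← Rat.cast_mul,
      one_div_mul_eq_div]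
  have generating_function := Polynomial.bernoulli_generating_function (1 / 2 : ℂ)
  rw [← generating_series, ← X_mul_expQuot, mul_left_comm] at generating_function
  exact mul_left_cancel₀ X_ne_zero generating_function

lemma bernoulli_eval_half_of_odd {n : ℕ} (hn : Odd n) :
    (Polynomial.bernoulli n).eval (1 / 2 : ℚ) = 0 := by
  have reflection := Polynomial.bernoulli_eval_one_sub n (1 / 2)
  rw [hn.neg_one_pow] at reflection
  norm_num at reflection ⊢
  linarith

lemma coeff_bernoulliPoly (m : ℕ) {n : ℕ} (hn : n < 2 * m + 2) :
    (bernoulliPoly m).coeff n = coeff n bernoulliHalfSeries := by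
  simp only [bernoulliPoly, Polynomial.finsetSum_coeff, Polynomial.coeff_monomial,
    bernoulliHalfSeries, coeff_mk]
  rcases Nat.even_or_odd' n with ⟨j, rfl | rfl⟩
  · rw [Finset.sum_eq_single_of_mem j (Finset.mem_range.2 (by omega))
      (fun i _ hi => if_neg (by omega)), if_pos rfl, corrCoeff]
  · rw [bernoulli_eval_half_of_odd (odd_two_mul_add_one j), zero_div, Rat.cast_zero]
    exact Finset.sum_eq_zero fun i _ => if_neg (by omega)

lemma X_pow_dvd_residualSeries (m : ℕ) : (X : ℂ⟦X⟧) ^ (2 * m + 2) ∣ residualSeries m := by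
  have tail : (X : ℂ⟦X⟧) ^ (2 * m + 2) ∣ bernoulliHalfSeries - bernoulliPoly m :=
    X_pow_dvd_iff.2 fun n hn => by
      rw [map_sub, Polynomial.coeff_coe, coeff_bernoulliPoly m hn, sub_self]
  rw [residualSeries, ← bernoulliHalfSeries_mul_expQuot, mul_comm _ expQuot, ← mul_sub]
  exact tail.mul_left expQuot

lemma isEntire_residualSeries (m : ℕ) : IsEntire (residualSeries m) :=
  (isEntire_rescale_exp _).sub (isEntire_expQuot.mul (isEntire_coe_polynomial _))

lemma evalSeries_residualSeries {R : Type*} [NormedRing R] [NormedAlgebra ℂ R] [NormOneClass R]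
    [CompleteSpace R] (m : ℕ) (x : R) : evalSeries (residualSeries m) x =
      NormedSpace.exp ((1 / 2 : ℂ) • x) -
        evalSeries expQuot x * Polynomial.aeval x (bernoulliPoly m) := by
  have entire_poly := isEntire_coe_polynomial (bernoulliPoly m)
  rw [residualSeries, evalSeries_sub (isEntire_rescale_exp _) (isEntire_expQuot.mul entire_poly),
    evalSeries_mul isEntire_expQuot entire_poly, evalSeries_rescale_exp, evalSeries_coe_polynomial]

end Bernoulli

section Ad

variable {𝔸 : Type*} [NormedRing 𝔸] [NormedAlgebra ℂ 𝔸]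

/-- The commutator map `adOp A` as a bounded operator, so that power series can be evaluated at
it. -/
noncomputable def adL (A : 𝔸) : 𝔸 →L[ℂ] 𝔸 :=
  ContinuousLinearMap.mul ℂ 𝔸 A - (ContinuousLinearMap.mul ℂ 𝔸).flip A

lemma adL_apply (A X : 𝔸) : adL A X = A * X - X * A := rfl

lemma adL_smul (A : 𝔸) (z : ℂ) : adL (z • A) = z • adL A := by
  ext X
  simp only [adL_apply, smul_mul_assoc, mul_smul_comm, _root_.smul_apply, smul_sub]

lemma adOp_iterate (A X : 𝔸) (n : ℕ) : (adOp A)^[n] X = (adL A ^ n) X := by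
  rw [FunLike.coe_pow_eq_iterate]
  rfl

lemma norm_adL_le (A : 𝔸) : ‖adL A‖ ≤ 2 * ‖A‖ := by
  refine ContinuousLinearMap.opNorm_le_bound _ (by positivity) fun X => ?_
  calc ‖A * X - X * A‖ ≤ ‖A‖ * ‖X‖ + ‖X‖ * ‖A‖ :=
        (norm_sub_le _ _).trans (add_le_add (norm_mul_le _ _) (norm_mul_le _ _))
    _ = 2 * ‖A‖ * ‖X‖ := by ring

variable [CompleteSpace 𝔸]

lemma exp_apply_eq_apply_exp {E : Type*} [NormedAddCommGroup E] [NormedSpace ℂ E] [CompleteSpace E]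
    {T : E →L[ℂ] E} {A : 𝔸} {v : E} (F : 𝔸 →L[ℂ] E) (h : ∀ n, (T ^ n) v = F (A ^ n)) :
    NormedSpace.exp T v = F (NormedSpace.exp A) := by
  have left_series := (NormedSpace.exp_series_hasSum_exp' (𝕂 := ℂ) T).mapL
    (ContinuousLinearMap.apply ℂ E v)
  have right_series := (NormedSpace.exp_series_hasSum_exp' (𝕂 := ℂ) A).mapL F
  refine left_series.unique (right_series.congr_fun fun n => ?_)
  rw [map_smul, map_smul, ContinuousLinearMap.apply_apply, h]

lemma exp_mulLeft_apply (A X : 𝔸) :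
    NormedSpace.exp (ContinuousLinearMap.mul ℂ 𝔸 A) X = NormedSpace.exp A * X :=
  exp_apply_eq_apply_exp ((ContinuousLinearMap.mul ℂ 𝔸).flip X) fun n => by
    rw [FunLike.coe_pow_eq_iterate]
    exact congrFun (mul_left_iterate A n) X

lemma exp_mulRight_apply (A X : 𝔸) :
    NormedSpace.exp ((ContinuousLinearMap.mul ℂ 𝔸).flip A) X = X * NormedSpace.exp A :=
  exp_apply_eq_apply_exp (ContinuousLinearMap.mul ℂ 𝔸 X) fun n => by
    rw [FunLike.coe_pow_eq_iterate]
    exact congrFun (mul_right_iterate A n) X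

lemma exp_adL_apply_mul_exp (A X : 𝔸) :
    NormedSpace.exp (adL A) X * NormedSpace.exp A = NormedSpace.exp A * X := by
  let : NormedAlgebra ℚ (𝔸 →L[ℂ] 𝔸) := NormedAlgebra.restrictScalars ℚ ℂ _
  have left_right_commute : Commute ((ContinuousLinearMap.mul ℂ 𝔸).flip A) (adL A) :=
    ContinuousLinearMap.ext fun Y => by
      simp only [mul_apply_eq_comp, adL_apply, ContinuousLinearMap.flip_apply,
        ContinuousLinearMap.mul_apply']
      noncomm_ring
  rw [← exp_mulRight_apply, ← exp_mulLeft_apply, ← mul_apply_eq_comp,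
    ← NormedSpace.exp_add_of_commute left_right_commute, adL, add_sub_cancel]

end Ad

section Duhamel

variable {𝔸 : Type*} [NormedRing 𝔸] [NormedAlgebra ℂ 𝔸]

lemma norm_factorial_inv_smul_pow_le [NormOneClass 𝔸] (x : 𝔸) {s : ℝ} (hs : ‖s‖ ≤ 1) (n : ℕ) :
    ‖(n.factorial : ℝ)⁻¹ • (s • x) ^ n‖ ≤ ‖x‖ ^ n / n.factorial := by
  rw [norm_smul, norm_inv, Real.norm_natCast, ← div_eq_inv_mul]
  gcongr
  refine (norm_pow_le _ n).trans (pow_le_pow_left₀ (norm_nonneg _) ?_ n)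
  rw [norm_smul]
  exact mul_le_of_le_one_left (norm_nonneg _) hs

variable [CompleteSpace 𝔸]

lemma exp_smul_adL_apply (s : ℝ) (X Y : 𝔸) : NormedSpace.exp (s • adL X) Y =
    NormedSpace.exp (s • X) * Y * NormedSpace.exp (-(s • X)) := by
  have conj := exp_adL_apply_mul_exp ((s : ℂ) • X) Y
  rw [adL_smul, Complex.coe_smul s X] at conj
  rw [← conj, mul_assoc, exp_mul_exp_neg, mul_one]
  rfl

lemma integral_exp_smul [NormOneClass 𝔸] (x : 𝔸) :
    ∫ s in (0 : ℝ)..1, NormedSpace.exp (s • x) = evalSeries expQuot x := by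
  have exp_series (s : ℝ) : HasSum (fun n => (n.factorial : ℝ)⁻¹ • (s • x) ^ n)
      (NormedSpace.exp (s • x)) := NormedSpace.exp_series_hasSum_exp' _
  have integrated_series : HasSum
      (fun n => ∫ s in (0 : ℝ)..1, (n.factorial : ℝ)⁻¹ • (s • x) ^ n)
      (∫ s in (0 : ℝ)..1, NormedSpace.exp (s • x)) := by
    refine intervalIntegral.hasSum_integral_of_dominated_convergence
      (fun n _ => ‖x‖ ^ n / n.factorial) (fun n => ?_) (fun n => ?_) ?_ ?_ ?_
    · have continuous_term : Continuous fun s : ℝ => (n.factorial : ℝ)⁻¹ • (s • x) ^ n := by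
        fun_prop
      exact continuous_term.aestronglyMeasurable
    · refine Filter.Eventually.of_forall fun s hs => norm_factorial_inv_smul_pow_le x ?_ n
      rw [Set.uIoc_of_le zero_le_one] at hs
      rw [Real.norm_of_nonneg hs.1.le]
      exact hs.2
    · exact Filter.Eventually.of_forall fun _ _ => Real.summable_pow_div_factorial ‖x‖
    · exact intervalIntegrable_const
    · exact Filter.Eventually.of_forall fun s _ => exp_series s
  rw [← integrated_series.tsum_eq, evalSeries]
  refine tsum_congr fun n => ?_
  have term_integral :
      ∫ s in (0 : ℝ)..1, (s • x) ^ n = ((n : ℝ) + 1)⁻¹ • x ^ n := by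
    simp only [smul_pow, intervalIntegral.integral_smul_const, integral_pow, one_pow,
      zero_pow n.succ_ne_zero, sub_zero, one_div]
  rw [intervalIntegral.integral_smul, term_integral, smul_smul, expQuot, PowerSeries.coeff_mk,
    ← Complex.coe_smul, Nat.factorial_succ]
  push_cast
  rw [mul_inv, mul_comm]

lemma exp_add_mul_exp_neg (X Y : 𝔸) : NormedSpace.exp (X + Y) * NormedSpace.exp (-X) =
    1 + ∫ s in (0 : ℝ)..1,
      NormedSpace.exp (s • (X + Y)) * Y * NormedSpace.exp (-(s • X)) := by
  have product_rule (s : ℝ) : HasDerivAt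
      (fun s : ℝ => NormedSpace.exp (s • (X + Y)) * NormedSpace.exp (s • -X))
      (NormedSpace.exp (s • (X + Y)) * Y * NormedSpace.exp (-(s • X))) s := by
    refine ((hasDerivAt_exp_smul_const (X + Y) s).mul
      (hasDerivAt_exp_smul_const' (-X) s)).congr_deriv ?_
    rw [smul_neg]
    noncomm_ring
  have continuous_deriv : Continuous fun s : ℝ =>
      NormedSpace.exp (s • (X + Y)) * Y * NormedSpace.exp (-(s • X)) := by
    have := (differentiable_exp (𝔸 := 𝔸)).continuous
    fun_prop
  rw [intervalIntegral.integral_eq_sub_of_hasDerivAt (fun s _ => product_rule s)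
    (continuous_deriv.intervalIntegrable 0 1)]
  simp only [one_smul, zero_smul, NormedSpace.exp_zero, mul_one, add_sub_cancel]

/-- Duhamel's formula conjugates `Y` by the exponentials of `s • X`, `s ∈ [0, 1]`, which integrates
the exponentials of `s • ad X` to `(exp (ad X) - 1) / ad X`. -/
lemma hasDerivAt_exp_add_smul [NormOneClass 𝔸] (X Y : 𝔸) :
    HasDerivAt (fun t : ℂ => NormedSpace.exp (X + t • Y))
      (evalSeries expQuot (adL X) Y * NormedSpace.exp X) 0 := by
  have : Nontrivial 𝔸 := NormOneClass.nontrivial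
  let slope (t : ℂ) : 𝔸 := ∫ s in (0 : ℝ)..1,
    NormedSpace.exp (s • (X + t • Y)) * Y * NormedSpace.exp (-(s • X))
  have continuous_exp := (differentiable_exp (𝔸 := 𝔸)).continuous
  have continuous_slope : Continuous slope :=
    intervalIntegral.continuous_parametric_intervalIntegral_of_continuous' (by fun_prop) _ _
  have slope_zero : slope 0 = evalSeries expQuot (adL X) Y := by
    have continuous_exp_adL : Continuous fun s : ℝ => NormedSpace.exp (s • adL X) :=
      (differentiable_exp (𝔸 := 𝔸 →L[ℂ] 𝔸)).continuous.comp (by fun_prop)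
    rw [← integral_exp_smul, ContinuousLinearMap.intervalIntegral_apply
      (continuous_exp_adL.intervalIntegrable 0 1)]
    simp only [slope, zero_smul, add_zero, exp_smul_adL_apply]
  have exp_eq (t : ℂ) :
      NormedSpace.exp (X + t • Y) = NormedSpace.exp X + t • (slope t * NormedSpace.exp X) := by
    have duhamel := exp_add_mul_exp_neg X (t • Y)
    simp only [mul_smul_comm, smul_mul_assoc, intervalIntegral.integral_smul] at duhamel
    calc NormedSpace.exp (X + t • Y)
        = NormedSpace.exp (X + t • Y) * NormedSpace.exp (-X) * NormedSpace.exp X := by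
          rw [mul_assoc, exp_neg_mul_exp, mul_one]
      _ = _ := by rw [duhamel, add_mul, one_mul, smul_mul_assoc]
  have slope_tendsto : Filter.Tendsto slope (nhdsWithin 0 {0}ᶜ) (nhds (slope 0)) :=
    continuous_slope.continuousAt.tendsto.mono_left nhdsWithin_le_nhds
  rw [hasDerivAt_iff_tendsto_slope_zero, ← slope_zero]
  refine (slope_tendsto.mul_const _).congr' ?_
  filter_upwards [self_mem_nhdsWithin] with t ht
  rw [zero_add, exp_eq, zero_smul, add_zero, add_sub_cancel_left, inv_smul_smul₀ ht]

end Duhamel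

section Corrector

variable {𝔸 : Type*} [NormedRing 𝔸] [NormedAlgebra ℂ 𝔸]

lemma corrector_one_eq (m : ℕ) (A B : 𝔸) (z : ℂ) : corrector m A B 1 z =
    ∑ j ∈ Finset.Icc 1 m, ((corrCoeff j : ℂ) * z ^ (2 * j)) • (adL A ^ (2 * j - 1)) B := by
  simp only [corrector, adOp_iterate, Complex.ofReal_one, one_smul]

lemma corrector_eq_smul (m : ℕ) (A B : 𝔸) (α : ℝ) (z : ℂ) :
    corrector m A B α z = (α : ℂ) • corrector m A B 1 z := by
  simp only [corrector, Complex.ofReal_one, one_smul]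

lemma corrector_smul (m : ℕ) (A B : 𝔸) (t z : ℂ) :
    corrector m A (t • B) 1 z = t • corrector m A B 1 z := by
  simp only [corrector_one_eq, map_smul, Finset.smul_sum]
  exact Finset.sum_congr rfl fun j _ => smul_comm _ _ _

lemma corrector_neg (m : ℕ) (A B : 𝔸) (α : ℝ) (z : ℂ) :
    corrector m A B α (-z) = corrector m A B α z := by
  simp only [corrector, (even_two_mul _).neg_pow]

lemma corrector_order_zero (A B : 𝔸) (α : ℝ) (z : ℂ) : corrector 0 A B α z = 0 := by
  simp [corrector]

lemma hasDerivAt_corrector_zero (m : ℕ) (A B : 𝔸) :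
    HasDerivAt (fun z => corrector m A B 1 z) 0 0 := by
  simp only [corrector_one_eq]
  refine (HasDerivAt.fun_sum fun j _ =>
    ((hasDerivAt_pow (2 * j) 0).const_mul _).smul_const _).congr_deriv ?_
  refine Finset.sum_eq_zero fun j hj => ?_
  rw [zero_pow (by grind), mul_zero, mul_zero, zero_smul]

lemma differentiable_corrector (m : ℕ) (A B : 𝔸) :
    Differentiable ℂ fun z => corrector m A B 1 z := by
  simp only [corrector_one_eq]
  fun_prop

lemma corrector_zero (m : ℕ) (A B : 𝔸) : corrector m A B 1 0 = 0 := by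
  rw [corrector_one_eq]
  refine Finset.sum_eq_zero fun j hj => ?_
  rw [zero_pow (by grind), mul_zero, zero_smul]

lemma aeval_smul_monomial_apply (T : 𝔸 →L[ℂ] 𝔸) (z c : ℂ) (n : ℕ) (X : 𝔸) :
    Polynomial.aeval (z • T) (Polynomial.monomial n c) X = (c * z ^ n) • (T ^ n) X := by
  have smul_pow_apply : ((z • T) ^ n) X = z ^ n • (T ^ n) X := by
    calc ((z • T) ^ n) X = (algebraMap ℂ (𝔸 →L[ℂ] 𝔸) z ^ n * T ^ n) X := by
          rw [← (Algebra.commute_algebraMap_left z T).mul_pow]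
          rfl
      _ = z ^ n • (T ^ n) X := by
          rw [← map_pow]
          rfl
  rw [Polynomial.aeval_monomial, mul_apply_eq_comp, smul_pow_apply, mul_smul]
  rfl

lemma aeval_bernoulliPoly_apply (m : ℕ) (A B : 𝔸) (z : ℂ) :
    Polynomial.aeval (z • adL A) (bernoulliPoly m) B = B + adL A (corrector m A B 1 z) := by
  have corrCoeff_zero : corrCoeff 0 = 1 := by simp [corrCoeff]
  rw [bernoulliPoly, Finset.range_eq_Ico, Finset.sum_eq_sum_Ico_succ_bot m.succ_pos, map_add,
    map_sum, _root_.add_apply, _root_.sum_apply, corrector_one_eq, map_sum]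
  simp only [aeval_smul_monomial_apply]
  congr 1
  · simp [corrCoeff_zero]
  · refine Finset.sum_congr (by ext; simp) fun j hj => ?_
    have : 2 * j - 1 + 1 = 2 * j := by have := (Finset.mem_Icc.1 hj).1; omega
    rw [map_smul, ← mul_apply_eq_comp, ← pow_succ', this]

/-- A bound for the corrector on the unit disc when `‖A‖, ‖B‖ ≤ M`. -/
noncomputable def correctorBound (m : ℕ) (M : ℝ) : ℝ :=
  ∑ j ∈ Finset.Icc 1 m, ‖(corrCoeff j : ℂ)‖ * ((2 * M) ^ (2 * j - 1) * M)

lemma norm_corrector_le [NormOneClass 𝔸] (m : ℕ) {A B : 𝔸} {M : ℝ} (hA : ‖A‖ ≤ M) (hB : ‖B‖ ≤ M)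
    {z : ℂ} (hz : ‖z‖ ≤ 1) : ‖corrector m A B 1 z‖ ≤ correctorBound m M := by
  have : Nontrivial 𝔸 := NormOneClass.nontrivial
  have hM : 0 ≤ M := (norm_nonneg A).trans hA
  rw [corrector_one_eq]
  refine norm_sum_le_of_le _ fun j _ => ?_
  rw [norm_smul, norm_mul, norm_pow]
  have norm_adL_pow_le : ‖adL A ^ (2 * j - 1)‖ ≤ (2 * M) ^ (2 * j - 1) :=
    (norm_pow_le _ _).trans (by gcongr; exact (norm_adL_le A).trans (by gcongr))
  refine mul_le_mul (mul_le_of_le_one_right (norm_nonneg _) (pow_le_one₀ (norm_nonneg _) hz))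
    ?_ (norm_nonneg _) (norm_nonneg _)
  exact (ContinuousLinearMap.le_opNorm _ _).trans (by gcongr)

end Corrector

section SecondOrder

variable {𝔸 : Type*} [NormedRing 𝔸] [NormedAlgebra ℂ 𝔸]

lemma pf2_eq (A B : 𝔸) (α : ℝ) : pf2 A B α = pf2 A ((α : ℂ) • B) 1 := by
  funext z
  simp only [pf2, smul_smul, mul_comm z, Complex.ofReal_one, one_mul]

lemma cpf2_eq (m : ℕ) (A B : 𝔸) (α : ℝ) : cpf2 m A B α = cpf2 m A ((α : ℂ) • B) 1 := by
  funext z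
  rw [cpf2, cpf2, corrector_smul, ← corrector_eq_smul, pf2_eq]

lemma cpf2_order_zero (A B : 𝔸) (α : ℝ) : cpf2 0 A B α = pf2 A B α := by
  funext z
  rw [cpf2, corrector_order_zero, neg_zero, NormedSpace.exp_zero, one_mul, mul_one]

lemma cpf2_apply_zero (m : ℕ) (A B : 𝔸) : cpf2 m A B 1 0 = 1 := by
  simp [cpf2, corrector_zero, pf2]

lemma mul_mul_mul_mul_eq_one {R : Type*} [Monoid R] {x y w x' y' w' : R} (hw : w * x' = 1)
    (hy : y * y' = 1) (hx : x * w' = 1) : x * y * w * (x' * y' * w') = 1 := by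
  calc x * y * w * (x' * y' * w') = x * (y * (w * x') * y') * w' := by simp only [mul_assoc]
    _ = 1 := by rw [hw, mul_one, hy, mul_one, hx]

variable [CompleteSpace 𝔸]

lemma pf2_mul_pf2_neg (A B : 𝔸) (z : ℂ) : pf2 A B 1 z * pf2 A B 1 (-z) = 1 := by
  have half_cancel := exp_mul_exp_neg ((z / 2) • A)
  simp only [pf2, neg_div, neg_smul, mul_neg]
  exact mul_mul_mul_mul_eq_one half_cancel (exp_mul_exp_neg _) half_cancel

lemma cpf2_mul_cpf2_neg (m : ℕ) (A B : 𝔸) (z : ℂ) : cpf2 m A B 1 z * cpf2 m A B 1 (-z) = 1 := by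
  simp only [cpf2, corrector_neg]
  exact mul_mul_mul_mul_eq_one (exp_neg_mul_exp _) (pf2_mul_pf2_neg A B z) (exp_mul_exp_neg _)

lemma exp_half_mul_exp_half (A : 𝔸) (z : ℂ) :
    NormedSpace.exp ((z / 2) • A) * NormedSpace.exp ((z / 2) • A) = NormedSpace.exp (z • A) := by
  rw [exp_smul_mul_exp_smul, add_halves]

lemma differentiable_pf2 (A B : 𝔸) : Differentiable ℂ (pf2 A B 1) := by
  have := differentiable_exp (𝔸 := 𝔸)
  unfold pf2
  fun_prop

lemma differentiable_cpf2 (m : ℕ) (A B : 𝔸) : Differentiable ℂ (cpf2 m A B 1) :=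
  ((differentiable_exp.comp (differentiable_corrector m A B)).mul (differentiable_pf2 A B)).mul
    (differentiable_exp.comp (differentiable_corrector m A B).neg)

lemma hasDerivAt_exp_comp_of_eq_zero {f : ℂ → 𝔸} {f' : 𝔸} {x : ℂ} (hf : HasDerivAt f f' x)
    (h0 : f x = 0) : HasDerivAt (fun z => NormedSpace.exp (f z)) f' x := by
  have exp_deriv : HasFDerivAt (NormedSpace.exp : 𝔸 → 𝔸) (1 : 𝔸 →L[ℂ] 𝔸) (f x) := by
    rw [h0]
    exact hasFDerivAt_exp_zero
  exact exp_deriv.comp_hasDerivAt x hf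

lemma hasDerivAt_pf2_zero (A B : 𝔸) : HasDerivAt (pf2 A B 1) (A + B) 0 := by
  have half : HasDerivAt (fun z : ℂ => NormedSpace.exp ((z / 2) • A)) ((1 / 2 : ℂ) • A) 0 :=
    hasDerivAt_exp_comp_of_eq_zero (((hasDerivAt_id 0).div_const 2).smul_const A) (by simp)
  have whole : HasDerivAt (fun z : ℂ => NormedSpace.exp ((((1 : ℝ) : ℂ) * z) • B)) B 0 := by
    simpa using hasDerivAt_exp_smul_zero B
  refine ((half.mul whole).mul half).congr_deriv ?_
  simp only [Pi.mul_apply, mul_zero, zero_div, zero_smul, NormedSpace.exp_zero, mul_one, one_mul]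
  module

lemma hasDerivAt_cpf2_zero (m : ℕ) (A B : 𝔸) : HasDerivAt (cpf2 m A B 1) (A + B) 0 := by
  have corrector_deriv := hasDerivAt_corrector_zero m A B
  have left := hasDerivAt_exp_comp_of_eq_zero corrector_deriv (corrector_zero m A B)
  have right := hasDerivAt_exp_comp_of_eq_zero corrector_deriv.fun_neg
    (by rw [corrector_zero, neg_zero])
  refine ((left.mul (hasDerivAt_pf2_zero A B)).mul right).congr_deriv ?_
  simp [corrector_zero]

lemma isOrder_two_cpf2 (m : ℕ) (A B : 𝔸) : IsOrder 2 (cpf2 m A B 1) (A + B) :=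
  (isOrder_one_of_hasDerivAt (differentiable_cpf2 m A B) (cpf2_apply_zero m A B)
    (hasDerivAt_cpf2_zero m A B)).succ_of_symmetric odd_one (cpf2_mul_cpf2_neg m A B)

end SecondOrder

section Bounds

variable {𝔸 : Type*} [NormedRing 𝔸] [NormedAlgebra ℂ 𝔸] [NormOneClass 𝔸]
  {A B : 𝔸} {M : ℝ} {z : ℂ}

lemma norm_exp_smul_add_le (hA : ‖A‖ ≤ M) (hB : ‖B‖ ≤ M) (hz : ‖z‖ ≤ 1) :
    ‖NormedSpace.exp (z • (A + B))‖ ≤ Real.exp (2 * M) := by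
  refine norm_exp_le_of_le ?_
  rw [norm_smul]
  exact (mul_le_of_le_one_left (norm_nonneg _) hz).trans
    ((norm_add_le_of_le hA hB).trans_eq (two_mul M).symm)

lemma norm_pf2_le (hA : ‖A‖ ≤ M) (hB : ‖B‖ ≤ M) (hz : ‖z‖ ≤ 1) :
    ‖pf2 A B 1 z‖ ≤ Real.exp (2 * M) := by
  have half_le : ‖NormedSpace.exp ((z / 2) • A)‖ ≤ Real.exp (M / 2) := by
    refine norm_exp_le_of_le ?_
    rw [norm_smul, norm_div, Complex.norm_two]
    nlinarith [norm_nonneg A, norm_nonneg z]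
  have whole_le : ‖NormedSpace.exp ((((1 : ℝ) : ℂ) * z) • B)‖ ≤ Real.exp M := by
    refine norm_exp_le_of_le ?_
    rw [Complex.ofReal_one, one_mul, norm_smul]
    exact (mul_le_of_le_one_left (norm_nonneg _) hz).trans hB
  calc ‖pf2 A B 1 z‖ ≤ Real.exp (M / 2) * Real.exp M * Real.exp (M / 2) :=
        norm_mul_le_of_le (norm_mul_le_of_le half_le whole_le) half_le
    _ = Real.exp (2 * M) := by rw [← Real.exp_add, ← Real.exp_add]; ring_nf

/-- A bound for the corrected second-order formula on the unit disc when `‖A‖, ‖B‖ ≤ M`. -/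
noncomputable def cpf2Bound (m : ℕ) (M : ℝ) : ℝ :=
  Real.exp (correctorBound m M) * Real.exp (2 * M) * Real.exp (correctorBound m M)

lemma norm_cpf2_le (m : ℕ) (hA : ‖A‖ ≤ M) (hB : ‖B‖ ≤ M) (hz : ‖z‖ ≤ 1) :
    ‖cpf2 m A B 1 z‖ ≤ cpf2Bound m M := by
  have corrector_le := norm_corrector_le m hA hB hz
  exact norm_mul_le_of_le (norm_mul_le_of_le (norm_exp_le_of_le corrector_le)
    (norm_pf2_le hA hB hz)) (norm_exp_le_of_le (by rwa [norm_neg]))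

end Bounds

section FirstOrderInCoupling

variable {𝔸 : Type*} [NormedRing 𝔸] [NormedAlgebra ℂ 𝔸]

lemma cpf2_smul_eq (m : ℕ) (A B : 𝔸) (t z : ℂ) : cpf2 m A (t • B) 1 z =
    NormedSpace.exp (t • corrector m A B 1 z) * (NormedSpace.exp ((z / 2) • A) *
      NormedSpace.exp (t • z • B) * NormedSpace.exp ((z / 2) • A)) *
      NormedSpace.exp (t • -corrector m A B 1 z) := by
  simp only [cpf2, corrector_smul, pf2, Complex.ofReal_one, one_mul, smul_neg, smul_comm t z]

variable [CompleteSpace 𝔸]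

lemma cpf2_right_zero (m : ℕ) (A : 𝔸) (z : ℂ) : cpf2 m A 0 1 z = NormedSpace.exp (z • A) := by
  simpa [exp_half_mul_exp_half] using cpf2_smul_eq m A 0 0 z

lemma differentiable_cpf2_smul (m : ℕ) (A B : 𝔸) (z : ℂ) :
    Differentiable ℂ fun t : ℂ => cpf2 m A (t • B) 1 z := by
  have := differentiable_exp (𝔸 := 𝔸)
  simp only [cpf2_smul_eq]
  fun_prop

lemma hasDerivAt_cpf2_smul (m : ℕ) (A B : 𝔸) (z : ℂ) :
    HasDerivAt (fun t : ℂ => cpf2 m A (t • B) 1 z)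
      (z • (NormedSpace.exp ((z / 2) • A) * B * NormedSpace.exp ((z / 2) • A))
        + corrector m A B 1 z * NormedSpace.exp (z • A)
        - NormedSpace.exp (z • A) * corrector m A B 1 z) 0 := by
  simp only [cpf2_smul_eq]
  refine (((hasDerivAt_exp_smul_zero (corrector m A B 1 z)).mul
    (((hasDerivAt_exp_smul_zero (z • B)).const_mul _).mul_const _)).mul
    (hasDerivAt_exp_smul_zero (-corrector m A B 1 z))).congr_deriv ?_
  simp only [Pi.mul_apply, zero_smul, NormedSpace.exp_zero, mul_one, one_mul,
    exp_half_mul_exp_half, mul_smul_comm, smul_mul_assoc, mul_neg]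
  abel

variable [NormOneClass 𝔸]

lemma hasDerivAt_exp_smul_add_smul (A B : 𝔸) (z : ℂ) :
    HasDerivAt (fun t : ℂ => NormedSpace.exp (z • (A + t • B)))
      (z • evalSeries expQuot (z • adL A) B * NormedSpace.exp (z • A)) 0 := by
  have derivative := hasDerivAt_exp_add_smul (z • A) (z • B)
  simpa only [smul_add, smul_comm _ z B, map_smul, adL_smul] using derivative

lemma hasLeadingError_cpf2_smul (m : ℕ) (A B : 𝔸) (z : ℂ) :
    HasLeadingError 1 (fun t => cpf2 m A (t • B) 1 z)
      (fun t => NormedSpace.exp (z • (A + t • B)))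
      (z • evalSeries (residualSeries m) (z • adL A) B * NormedSpace.exp (z • A)) := by
  have : Nontrivial 𝔸 := NormOneClass.nontrivial
  set E := NormedSpace.exp (z • A)
  set C := corrector m A B 1 z
  have differentiable_flow : Differentiable ℂ fun t : ℂ => NormedSpace.exp (z • (A + t • B)) := by
    have := differentiable_exp (𝔸 := 𝔸)
    fun_prop
  have half_conj : NormedSpace.exp ((z / 2) • A) * B * NormedSpace.exp ((z / 2) • A) =
      NormedSpace.exp ((1 / 2 : ℂ) • z • adL A) B * E := by
    rw [← exp_adL_apply_mul_exp, mul_assoc, exp_half_mul_exp_half, adL_smul, smul_smul,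
      one_div_mul_eq_div]
  have corrector_conj : E * C = (C + evalSeries expQuot (z • adL A) (z • adL A C)) * E := by
    have exp_eq : NormedSpace.exp (z • adL A) =
        1 + evalSeries expQuot (z • adL A) * (z • adL A) := by
      rw [evalSeries_expQuot_mul, add_sub_cancel]
    rw [← exp_adL_apply_mul_exp, adL_smul, exp_eq]
    rfl
  have residual_apply : evalSeries (residualSeries m) (z • adL A) B =
      NormedSpace.exp ((1 / 2 : ℂ) • z • adL A) B
        - evalSeries expQuot (z • adL A) (B + adL A C) := by
    rw [evalSeries_residualSeries, ← aeval_bernoulliPoly_apply]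
    rfl
  convert! hasLeadingError_one_of_hasDerivAt (differentiable_cpf2_smul m A B z)
    differentiable_flow (by simp [cpf2_right_zero]) (hasDerivAt_cpf2_smul m A B z)
    (hasDerivAt_exp_smul_add_smul A B z) using 1
  rw [residual_apply, half_conj, corrector_conj, map_add, map_smul]
  simp only [smul_mul_assoc, add_mul, sub_mul, smul_sub, smul_add]
  abel

end FirstOrderInCoupling

section ResidualBound

/-- A bound, when `‖A‖, ‖B‖ ≤ M`, for the ratio of the first-order error of the corrected
second-order formula to `z ^ (2 * m + 3)`. -/
noncomputable def residualBound (m : ℕ) (M : ℝ) : ℝ :=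
  (∑' n, ‖PowerSeries.coeff n (residualSeries m)‖ * (2 * M) ^ n) * M * Real.exp M

lemma residualBound_nonneg (m : ℕ) {M : ℝ} (hM : 0 ≤ M) : 0 ≤ residualBound m M := by
  have : 0 ≤ ∑' n, ‖PowerSeries.coeff n (residualSeries m)‖ * (2 * M) ^ n :=
    tsum_nonneg fun n => by positivity
  unfold residualBound
  positivity

lemma norm_smul_evalSeries_residualSeries_mul_exp_le {𝔸 : Type*} [NormedRing 𝔸]
    [NormedAlgebra ℂ 𝔸] [NormOneClass 𝔸] (m : ℕ) {A B : 𝔸} {M : ℝ} (hA : ‖A‖ ≤ M)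
    (hB : ‖B‖ ≤ M) {z : ℂ} (hz : ‖z‖ ≤ 1) :
    ‖z • evalSeries (residualSeries m) (z • adL A) B * NormedSpace.exp (z • A)‖ ≤
      residualBound m M * ‖z‖ ^ (2 * m + 3) := by
  have : Nontrivial 𝔸 := NormOneClass.nontrivial
  have residual_le := norm_evalSeries_smul_le (isEntire_residualSeries m)
    (X_pow_dvd_residualSeries m) ((norm_adL_le A).trans (mul_le_mul_of_nonneg_left hA zero_le_two))
    hz
  have exp_le : ‖NormedSpace.exp (z • A)‖ ≤ Real.exp M := norm_exp_le_of_le (by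
    rw [norm_smul]
    exact (mul_le_of_le_one_left (norm_nonneg _) hz).trans hA)
  rw [smul_mul_assoc, norm_smul]
  calc ‖z‖ * ‖evalSeries (residualSeries m) (z • adL A) B * NormedSpace.exp (z • A)‖
      ≤ ‖z‖ * ((∑' n, ‖PowerSeries.coeff n (residualSeries m)‖ * (2 * M) ^ n) *
          ‖z‖ ^ (2 * m + 2) * M * Real.exp M) := by
        gcongr
        exact norm_mul_le_of_le (ContinuousLinearMap.le_of_opNorm_le_of_le _ residual_le hB) exp_le
    _ = residualBound m M * ‖z‖ ^ (2 * m + 3) := by rw [residualBound]; ring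

end ResidualBound

section ErrorBounds

variable {𝔸 : Type*} [NormedRing 𝔸] [NormedAlgebra ℂ 𝔸]

lemma cpf_eq (m k : ℕ) (A B : 𝔸) (α : ℝ) : cpf m k A B α = cpf m k A ((α : ℂ) • B) 1 := by
  rw [cpf, cpf, cpf2_eq]

lemma pf_eq_cpf_zero (k : ℕ) (A B : 𝔸) (α : ℝ) : pf k A B α = cpf 0 k A B α := by
  rw [pf, cpf, funext (cpf2_order_zero A B)]

variable [CompleteSpace 𝔸] [NormOneClass 𝔸] {A B : 𝔸} {M : ℝ} {z : ℂ}

/-- A bound for the distance of the corrected formula of order `2 * k + 2` from the flow on the unit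
disc when `‖A‖, ‖B‖ ≤ M`. -/
noncomputable def flowDistBound (m k : ℕ) (M : ℝ) : ℝ :=
  cpf2Bound m M ^ 5 ^ k + Real.exp (2 * M)

lemma norm_cpf_sub_exp_le (m k : ℕ) (hA : ‖A‖ ≤ M) (hB : ‖B‖ ≤ M) (hz : ‖z‖ ≤ 1) :
    ‖cpf m (k + 1) A B 1 z - NormedSpace.exp (z • (A + B))‖ ≤
      flowDistBound m k M * ‖z‖ ^ (2 * k + 3) :=
  (isOrder_suzuki (isOrder_two_cpf2 m A B) (cpf2_mul_cpf2_neg m A B) k).norm_sub_exp_le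
    (fun _ hw => norm_sub_le_of_le (norm_suzuki_le (fun _ => norm_cpf2_le m hA hB) k hw)
      (norm_exp_smul_add_le hA hB hw)) hz

lemma norm_cpf_smul_sub_exp_le (m k : ℕ) (hA : ‖A‖ ≤ M) (hB : ‖B‖ ≤ M) (hz : ‖z‖ ≤ 1) {t : ℂ}
    (ht : ‖t‖ ≤ 1) : ‖cpf m (k + 1) A (t • B) 1 z - NormedSpace.exp (z • (A + t • B))‖ ≤
      flowDistBound m k M * ‖z‖ ^ (2 * k + 3) := by
  refine norm_cpf_sub_exp_le m k hA ?_ hz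
  rw [norm_smul]
  exact (mul_le_of_le_one_left (norm_nonneg _) ht).trans hB

lemma exists_hasLeadingError_cpf_smul (m k : ℕ) (hA : ‖A‖ ≤ M) (hB : ‖B‖ ≤ M) (hz : ‖z‖ ≤ 1) :
    ∃ e, ‖e‖ ≤ (5 * Real.exp M ^ 4) ^ k * residualBound m M * ‖z‖ ^ (2 * m + 3) ∧
      HasLeadingError 1 (fun t => cpf m (k + 1) A (t • B) 1 z)
        (fun t => NormedSpace.exp (z • (A + t • B))) e := by
  have hM : 0 ≤ M := (norm_nonneg A).trans hA
  rw [mul_assoc]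
  refine exists_hasLeadingError_suzuki one_ne_zero (fun w hw => ?_) (fun w hw =>
    ⟨_, ?_, hasLeadingError_cpf2_smul m A B w⟩) k le_rfl
  · refine norm_exp_le_of_le ?_
    rw [zero_smul, add_zero, norm_smul]
    exact (mul_le_of_le_one_left (norm_nonneg _) (hw.trans hz)).trans hA
  · refine (norm_smul_evalSeries_residualSeries_mul_exp_le m hA hB (hw.trans hz)).trans ?_
    have := residualBound_nonneg m hM
    gcongr

lemma norm_cpf_smul_sub_exp_le_mul (m k : ℕ) (hA : ‖A‖ ≤ M) (hB : ‖B‖ ≤ M) (hz : ‖z‖ ≤ 1) {t : ℂ}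
    (ht : ‖t‖ ≤ 1) : ‖cpf m (k + 1) A (t • B) 1 z - NormedSpace.exp (z • (A + t • B))‖ ≤
      flowDistBound m k M * (‖t‖ * ‖z‖ ^ (2 * k + 3)) := by
  obtain ⟨e, -, leading⟩ := exists_hasLeadingError_cpf_smul m k hA hB hz
  have bound := leading.norm_sub_le_mul_pow (fun _ => norm_cpf_smul_sub_exp_le m k hA hB hz) ht
  exact bound.trans_eq (by ring)

/-- A constant in the error of the corrected formula of order `2 * k + 2` when `‖A‖, ‖B‖ ≤ M`. -/
noncomputable def cpfErrorConst (m k : ℕ) (M : ℝ) : ℝ :=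
  flowDistBound m k M + 2 * ((5 * Real.exp M ^ 4) ^ k * residualBound m M)

lemma flowDistBound_nonneg (m k : ℕ) (M : ℝ) : 0 ≤ flowDistBound m k M := by
  unfold flowDistBound cpf2Bound
  positivity

lemma cpfErrorConst_nonneg (m k : ℕ) {M : ℝ} (hM : 0 ≤ M) : 0 ≤ cpfErrorConst m k M := by
  have := residualBound_nonneg m hM
  have := flowDistBound_nonneg m k M
  unfold cpfErrorConst
  positivity

lemma norm_cpf_smul_sub_exp_le_sq_add (m k : ℕ) (hA : ‖A‖ ≤ M) (hB : ‖B‖ ≤ M) (hz : ‖z‖ ≤ 1)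
    {t : ℂ} (ht : ‖t‖ ≤ 1) :
    ‖cpf m (k + 1) A (t • B) 1 z - NormedSpace.exp (z • (A + t • B))‖ ≤
      cpfErrorConst m k M * (‖t‖ ^ 2 * ‖z‖ ^ (2 * k + 3) + ‖t‖ * ‖z‖ ^ (2 * m + 3)) := by
  set δ := flowDistBound m k M
  set ε := (5 * Real.exp M ^ 4) ^ k * residualBound m M
  have δ_nonneg : 0 ≤ δ := flowDistBound_nonneg m k M
  have ε_nonneg : 0 ≤ ε :=
    mul_nonneg (by positivity) (residualBound_nonneg m ((norm_nonneg A).trans hA))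
  obtain ⟨e, he, leading⟩ := exists_hasLeadingError_cpf_smul m k hA hB hz
  calc _ ≤ ε * ‖z‖ ^ (2 * m + 3) * ‖t‖ ^ 1
          + (δ * ‖z‖ ^ (2 * k + 3) + ε * ‖z‖ ^ (2 * m + 3)) * ‖t‖ ^ (1 + 1) :=
        leading.norm_sub_le_of_norm_leading_le
          (fun _ => norm_cpf_smul_sub_exp_le m k hA hB hz) he ht
    _ = δ * (‖t‖ ^ 2 * ‖z‖ ^ (2 * k + 3)) + ε * (‖t‖ * ‖z‖ ^ (2 * m + 3)) * (1 + ‖t‖) := by ring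
    _ ≤ (δ + 2 * ε) * (‖t‖ ^ 2 * ‖z‖ ^ (2 * k + 3))
          + (δ + 2 * ε) * (‖t‖ * ‖z‖ ^ (2 * m + 3)) := by
        have : ε * (1 + ‖t‖) ≤ δ + 2 * ε := by nlinarith
        rw [mul_right_comm]
        gcongr
        linarith
    _ = cpfErrorConst m k M * (‖t‖ ^ 2 * ‖z‖ ^ (2 * k + 3) + ‖t‖ * ‖z‖ ^ (2 * m + 3)) := by
        rw [cpfErrorConst, mul_add]

variable {α : ℝ}

lemma norm_exp_sub_cpf_le (m k : ℕ) (hA : ‖A‖ ≤ M) (hB : ‖B‖ ≤ M) (hα : 0 ≤ α) (hα1 : α ≤ 1)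
    (hz : ‖z‖ ≤ 1) : ‖NormedSpace.exp (z • (A + (α : ℂ) • B)) - cpf m (k + 1) A B α z‖ ≤
      cpfErrorConst m k M * (α ^ 2 * ‖z‖ ^ (2 * k + 3) + α * ‖z‖ ^ (2 * m + 3)) := by
  have norm_α : ‖(α : ℂ)‖ = α := Complex.norm_of_nonneg hα
  rw [norm_sub_rev, cpf_eq]
  simpa only [norm_α] using norm_cpf_smul_sub_exp_le_sq_add m k hA hB hz (norm_α.trans_le hα1)

lemma norm_exp_sub_pf_le (k : ℕ) (hA : ‖A‖ ≤ M) (hB : ‖B‖ ≤ M) (hα : 0 ≤ α) (hα1 : α ≤ 1)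
    (hz : ‖z‖ ≤ 1) : ‖NormedSpace.exp (z • (A + (α : ℂ) • B)) - pf (k + 1) A B α z‖ ≤
      flowDistBound 0 k M * (α * ‖z‖ ^ (2 * k + 3)) := by
  have norm_α : ‖(α : ℂ)‖ = α := Complex.norm_of_nonneg hα
  rw [norm_sub_rev, pf_eq_cpf_zero, cpf_eq]
  simpa only [norm_α] using norm_cpf_smul_sub_exp_le_mul 0 k hA hB hz (norm_α.trans_le hα1)

lemma sq_mul_pow_add_mul_pow_le {k m : ℕ} (hkm : k ≤ m) {r : ℝ} (hα : 0 ≤ α) (hr : 0 ≤ r)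
    (h : r ^ (2 * (m - k) + 2) ≤ α) :
    α ^ 2 * r ^ (2 * k + 1) + α * r ^ (2 * m + 3) ≤ 2 * (α ^ 2 * r ^ (2 * k + 1)) := by
  obtain ⟨d, rfl⟩ := Nat.exists_eq_add_of_le hkm
  rw [Nat.add_sub_cancel_left] at h
  calc α ^ 2 * r ^ (2 * k + 1) + α * r ^ (2 * (k + d) + 3)
      = α ^ 2 * r ^ (2 * k + 1) + α * (r ^ (2 * d + 2) * r ^ (2 * k + 1)) := by ring
    _ ≤ α ^ 2 * r ^ (2 * k + 1) + α * (α * r ^ (2 * k + 1)) := by gcongr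
    _ = 2 * (α ^ 2 * r ^ (2 * k + 1)) := by ring

end ErrorBounds

end CorrectedPF

theorem mainTheorem2 (k m : ℕ) (hk : 1 ≤ k) (hkm : k ≤ m) (M : ℝ) :
    ∃ K : ℝ, ∀ (𝔸 : Type*) [NormedRing 𝔸] [NormOneClass 𝔸] [NormedAlgebra ℂ 𝔸]
      [CompleteSpace 𝔸] (A B : 𝔸), ‖A‖ ≤ M → ‖B‖ ≤ M →
      ∀ (α : ℝ) (z : ℂ), 0 < α → α ≤ 1 → ‖z‖ ≤ 1 →
        ‖NormedSpace.exp (z • (A + (α : ℂ) • B)) - CorrectedPF.cpf m k A B α z‖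
            ≤ K * (α ^ 2 * ‖z‖ ^ (2 * k + 1) + α * ‖z‖ ^ (2 * m + 3)) ∧
        (‖z‖ ^ (2 * (m - k) + 2) ≤ α →
          ‖NormedSpace.exp (z • (A + (α : ℂ) • B)) - CorrectedPF.cpf m k A B α z‖
            ≤ K * (α ^ 2 * ‖z‖ ^ (2 * k + 1))) ∧
        ‖NormedSpace.exp (z • (A + (α : ℂ) • B)) - CorrectedPF.pf k A B α z‖
            ≤ K * (α * ‖z‖ ^ (2 * k + 1)) := by
  obtain ⟨l, rfl⟩ := Nat.exists_eq_add_of_le' hk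
  refine ⟨2 * CorrectedPF.cpfErrorConst m l M + CorrectedPF.flowDistBound 0 l M,
    fun 𝔸 _ _ _ _ A B hA hB α z hα hα1 hz => ?_⟩
  have hM : 0 ≤ M := (norm_nonneg A).trans hA
  have corrected := CorrectedPF.norm_exp_sub_cpf_le m l hA hB hα.le hα1 hz
  have standard := CorrectedPF.norm_exp_sub_pf_le l hA hB hα.le hα1 hz
  have corrected_const_nonneg := CorrectedPF.cpfErrorConst_nonneg m l hM
  have standard_const_nonneg := CorrectedPF.flowDistBound_nonneg 0 l M
  refine ⟨corrected.trans ?_, fun small => corrected.trans ?_, standard.trans ?_⟩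
  · gcongr ?_ * _
    linarith
  · have absorbed := CorrectedPF.sq_mul_pow_add_mul_pow_le hkm hα.le (norm_nonneg z) small
    calc _ ≤ CorrectedPF.cpfErrorConst m l M * (2 * (α ^ 2 * ‖z‖ ^ (2 * (l + 1) + 1))) :=
          mul_le_mul_of_nonneg_left absorbed corrected_const_nonneg
      _ = 2 * CorrectedPF.cpfErrorConst m l M * (α ^ 2 * ‖z‖ ^ (2 * (l + 1) + 1)) := by ring
      _ ≤ _ := by
          gcongr ?_ * _
          exact le_add_of_nonneg_right standard_const_nonneg
  · gcongr ?_ * _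
    linarith
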